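/- Let $\mathcal H$ be a complex Hilbert space with inner product $\langle\cdot|\cdot\rangle$ and norm $\|\cdot\|$, let $\mathcal D$ be a dense subspace of $\mathcal H$, and let $\Omega$ be a sesquilinear form on $\mathcal D$ (linear in the first argument). A form $\Theta$ on $\mathcal D$ is symmetric if $\Theta(\xi,\eta)=\overline{\Theta(\eta,\xi)}$ for all $\xi,\eta\in\mathcal D$, and $\iota(\xi,\eta)=\langle\xi|\eta\rangle$. Definitions. (a) $\Omega$ is q-closed with respect to a norm $\|\cdot\|_\Omega$ on $\mathcal D$ if (1) $\|\xi\|\le\alpha\|\xi\|_\Omega$ for all $\xi\in\mathcal D$ and some $\alpha>0$; (2) $\|\xi_n\|_\Omega\to0$ for every sequence in $\mathcal D$ with $\|\xi_n\|\to0$ and $\|\xi_n-\xi_m\|_\Omega\to0$; (3) $\mathcal E_\Omega:=\mathcal D[\|\cdot\|_\Omega]$ is a reflexive Banach space; (4) $|\Omega(\xi,\eta)|\le\beta\|\xi\|_\Omega\|\eta\|_\Omega$ for all $\xi,\eta\in\mathcal D$ and some $\beta>0$. In that case $\mathfrak P(\Omega)$ denotes the set of bounded sesquilinear forms $\Upsilon$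 on $\mathcal H$ such that $\xi=0$ is the only $\xi\in\mathcal D$ with $(\Omega+\Upsilon)(\xi,\eta)=0$ for all $\eta\in\mathcal D$, and such that for every bounded conjugate linear functional $\Lambda$ on $\mathcal E_\Omega$ there is $\xi\in\mathcal D$ with $\Lambda(\eta)=(\Omega+\Upsilon)(\xi,\eta)$ for all $\eta\in\mathcal D$. $\Omega$ is solvable with respect to $\|\cdot\|_\Omega$ if it is q-closed with respect to it and $\mathfrak P(\Omega)\neq\emptyset$; it is solvable with respect to an inner product if this holds for the norm induced by some inner product on $\mathcal D$, and then $\mathfrak P(\Omega)$ is formed with that norm. (b) For a form $\Theta$ on $\mathcal D$, the pair $(\mathcal D,\Theta)$ is a Krein space if $\Theta$ is symmetric and $\mathcal D$ has a fundamental decomposition, i.e. is a direct sum $\mathcal D=\mathcal D_+\oplus\mathcal D_-$ of $\Theta$-orthogonal subspaces such that $(\mathcal D_+,\Theta)$ and $(\mathcal D_-,-\Theta)$ are Hilbert spaces. Its topology is that of the norm $(\Theta(\xi_+,\xi_+)-\Theta(\xi_-,\xi_-))^{1/2}$ of $\xi=\xi_++\xi_-$, which does not depend on the decomposition. It is continuously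 embedded in $\mathcal H$ if the inclusion $\mathcal D\to\mathcal H$ is continuous for this topology. (c) A symmetric form $\Omega$ on $\mathcal D$ is closed with gap point $\lambda$ (in the sense of Fleige, Hassi and de Snoo) if $(\mathcal D,\Omega-\lambda\iota)$ is a Krein space which is continuously embedded in $\mathcal H$. Theorem. Let $\Upsilon$ be a bounded sesquilinear form on $\mathcal H$ such that $\Omega+\Upsilon$ is symmetric on $\mathcal D$. Then $\Omega$ is solvable with respect to an inner product and $\Upsilon\in\mathfrak P(\Omega)$ if, and only if, $(\mathcal D,\Omega+\Upsilon)$ is a Krein space which is continuously embedded in $\mathcal H$. Corollary. If $\Omega$ is symmetric and $\lambda\in\mathbb R$, then $\Omega$ is closed with gap point $\lambda$ if, and only if, $\Omega$ is solvable with respect to an inner product and $-\lambda\iota\in\mathfrak P(\Omega)$. -/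

import Mathlib

open scoped ComplexConjugate Topology InnerProductSpace
open Filter

noncomputable section

/-! ### Norms on a complex vector space

A space may carry several norms, so norms are treated as objects. `Renormed ν` is the
normed space `V[ν]`. -/

/-- A norm on the complex vector space `V`. -/
structure VectorNorm (V : Type*) [AddCommGroup V] [Module ℂ V] where
  toSeminorm : Seminorm ℂ V
  eq_zero_of_apply_eq_zero : ∀ x, toSeminorm x = 0 → x = 0

instance {V : Type*} [AddCommGroup V] [Module ℂ V] :
    CoeFun (VectorNorm V) (fun _ => V → ℝ) := ⟨fun ν x => ν.toSeminorm x⟩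

/-- The space `V[ν]`: the vector space `V` with the norm `ν`. -/
def Renormed {V : Type*} [AddCommGroup V] [Module ℂ V] (_ν : VectorNorm V) : Type _ := V

namespace Renormed

variable {V : Type*} [AddCommGroup V] [Module ℂ V] (ν : VectorNorm V)

instance : AddCommGroup (Renormed ν) := inferInstanceAs (AddCommGroup V)

instance : Module ℂ (Renormed ν) := inferInstanceAs (Module ℂ V)

/-- The identity map of `V`, from `V` onto `V[ν]`. -/
def mk : V ≃ₗ[ℂ] Renormed ν := LinearEquiv.refl ℂ V

instance : Norm (Renormed ν) := ⟨fun x => ν ((mk ν).symm x)⟩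

theorem norm_mk (x : V) : ‖mk ν x‖ = ν x := rfl

theorem core : NormedSpace.Core ℂ (Renormed ν) where
  norm_nonneg x := apply_nonneg ν.toSeminorm ((mk ν).symm x)
  norm_smul c x := map_smul_eq_mul ν.toSeminorm c ((mk ν).symm x)
  norm_triangle x y := map_add_le_add ν.toSeminorm ((mk ν).symm x) ((mk ν).symm y)
  norm_eq_zero_iff x :=
    ⟨ν.eq_zero_of_apply_eq_zero ((mk ν).symm x), by
      rintro rfl
      exact map_zero ν.toSeminorm⟩

instance : NormedAddCommGroup (Renormed ν) := NormedAddCommGroup.ofCore (core ν)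

instance : NormedSpace ℂ (Renormed ν) := NormedSpace.ofCore (core ν)

end Renormed

/-- The norm `ξ ↦ ⟨ξ, ξ⟩ ^ (1/2)` induced by an inner product on `V`. -/
def VectorNorm.ofInner {V : Type*} [AddCommGroup V] [Module ℂ V]
    (c : InnerProductSpace.Core ℂ V) : VectorNorm V where
  toSeminorm := Seminorm.of (fun x => √(c.inner x x).re)
    (fun x y => by
      let _ := c.toNormedAddCommGroup
      exact norm_add_le x y)
    (fun a x => by
      let _ := c.toNormedAddCommGroup
      let _ : NormedSpace ℂ V := InnerProductSpace.Core.toNormedSpace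
      exact norm_smul a x)
  eq_zero_of_apply_eq_zero := fun x hx => by
    let _ := c.toNormedAddCommGroup
    exact norm_eq_zero.mp hx

theorem VectorNorm.ofInner_apply {V : Type*} [AddCommGroup V] [Module ℂ V]
    (c : InnerProductSpace.Core ℂ V) (x : V) :
    VectorNorm.ofInner c x = √(c.inner x x).re := rfl

/-- A normed space is reflexive if its canonical map into the double dual is onto. -/
def IsReflexiveSpace (E : Type*) [NormedAddCommGroup E] [NormedSpace ℂ E] : Prop :=
  Function.Surjective (NormedSpace.inclusionInDoubleDual ℂ E)

/-! ### Sesquilinear forms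

All forms are linear in the first and conjugate linear in the second argument. -/

/-- Sesquilinear forms on `V`. -/
abbrev SesqForm (V : Type*) [AddCommGroup V] [Module ℂ V] := V →ₗ[ℂ] V →ₗ⋆[ℂ] ℂ

/-- Bounded sesquilinear forms on the whole of the space `H`. -/
abbrev BoundedSesqForm (H : Type*) [NormedAddCommGroup H] [InnerProductSpace ℂ H] :=
  H →L[ℂ] H →L⋆[ℂ] ℂ

/-- A form is symmetric if it coincides with its adjoint. -/
def SesqForm.IsSymmetric {V : Type*} [AddCommGroup V] [Module ℂ V] (Θ : SesqForm V) : Prop :=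
  ∀ ξ η : V, Θ ξ η = conj (Θ η ξ)

/-- The form `ι(ξ, η) = ⟨ξ | η⟩` given by the inner product of `H`, linear in `ξ`.
(The inner product of Mathlib is linear in the second argument.) -/
def iotaForm (H : Type*) [NormedAddCommGroup H] [InnerProductSpace ℂ H] :
    BoundedSesqForm H := (innerSL ℂ).flip

theorem iotaForm_apply {H : Type*} [NormedAddCommGroup H] [InnerProductSpace ℂ H] (ξ η : H) :
    iotaForm H ξ η = ⟪η, ξ⟫_ℂ := rfl

/-- The restriction of a bounded form on `H` to a subspace `D`. -/
def BoundedSesqForm.restrict {H : Type*} [NormedAddCommGroup H] [InnerProductSpace ℂ H]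
    (Υ : BoundedSesqForm H) (D : Submodule ℂ H) : SesqForm D :=
  LinearMap.mk₂'ₛₗ (RingHom.id ℂ) (starRingEnd ℂ) (fun ξ η : D => Υ (ξ : H) (η : H))
    (fun _ _ _ => by simp) (fun _ _ _ => by simp) (fun _ _ _ => by simp) (fun _ _ _ => by simp)

section Solvable

variable {H : Type*} [NormedAddCommGroup H] [InnerProductSpace ℂ H] {D : Submodule ℂ H}

/-- The norm `ν` on `D` is compatible with the inner product of `H`. -/
structure IsCompatibleNorm (ν : VectorNorm D) : Prop where
  embedding : ∃ α > 0, ∀ ξ : D, ‖(ξ : H)‖ ≤ α * ν ξ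
  closable : ∀ u : ℕ → D, Tendsto (fun n => ‖(u n : H)‖) atTop (𝓝 0) →
    Tendsto (fun p : ℕ × ℕ => ν (u p.1 - u p.2)) atTop (𝓝 0) →
    Tendsto (fun n => ν (u n)) atTop (𝓝 0)

/-- `Ω` is q-closed with respect to the norm `ν` on its domain `D`. -/
structure IsQClosed (Ω : SesqForm D) (ν : VectorNorm D) : Prop where
  compatible : IsCompatibleNorm ν
  complete : CompleteSpace (Renormed ν)
  reflexive : IsReflexiveSpace (Renormed ν)
  bounded : ∃ β > 0, ∀ ξ η : D, ‖Ω ξ η‖ ≤ β * ν ξ * ν η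

/-- The set `𝔓(Ω)` of the bounded forms `Υ` on `H` such that `N(Ω + Υ) = {0}` and every bounded
conjugate linear functional `Λ` on `D[ν]` is of the form `Λ η = (Ω + Υ)(ξ, η)`, for some `ξ`. -/
def solvingForms (Ω : SesqForm D) (ν : VectorNorm D) : Set (BoundedSesqForm H) :=
  {Υ | (∀ ξ : D, (∀ η : D, (Ω + Υ.restrict D) ξ η = 0) → ξ = 0) ∧
    ∀ Λ : Renormed ν →L⋆[ℂ] ℂ, ∃ ξ : D, ∀ η : D,
      Λ (Renormed.mk ν η) = (Ω + Υ.restrict D) ξ η}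

/-- `Ω` is solvable with respect to the norm `ν`. -/
def IsSolvableForm (Ω : SesqForm D) (ν : VectorNorm D) : Prop :=
  IsQClosed Ω ν ∧ (solvingForms Ω ν).Nonempty

end Solvable

/-! ### Krein spaces -/

section Krein

variable {V : Type*} [AddCommGroup V] [Module ℂ V]

/-- `(V, Θ)` is a Hilbert space: `Θ` is an inner product on `V` and `V` is complete in the norm
which it induces. -/
def IsHilbertForm (Θ : SesqForm V) : Prop :=
  ∃ c : InnerProductSpace.Core ℂ V,
    (∀ ξ η : V, c.inner ξ η = Θ η ξ) ∧ CompleteSpace (Renormed (VectorNorm.ofInner c))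

/-- `V = P [+] N` is a fundamental decomposition of `(V, Θ)` into Hilbert spaces:
a `Θ`-orthogonal direct sum for which `(P, Θ)` and `(N, -Θ)` are Hilbert spaces. -/
structure IsFundamentalDecomposition (Θ : SesqForm V) (P N : Submodule ℂ V) : Prop where
  isCompl : IsCompl P N
  orthogonal : ∀ ξ ∈ P, ∀ η ∈ N, Θ ξ η = 0
  pos : IsHilbertForm (Θ.domRestrict₁₂ P P)
  neg : IsHilbertForm ((-Θ).domRestrict₁₂ N N)

/-- `(V, Θ)` is a Krein space. -/
def IsKreinSpace (Θ : SesqForm V) : Prop :=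
  Θ.IsSymmetric ∧ ∃ P N : Submodule ℂ V, IsFundamentalDecomposition Θ P N

/-- The square of the norm of `ξ + η`, for `ξ ∈ P` and `η ∈ N`, in the Hilbert space
topology given by a fundamental decomposition `V = P [+] N`. -/
def fundamentalNormSq (Θ : SesqForm V) (ξ η : V) : ℝ := (Θ ξ ξ).re - (Θ η η).re

theorem IsHilbertForm.continuous_apply {Θ : SesqForm V} {c : InnerProductSpace.Core ℂ V}
    (hc : ∀ ξ η : V, c.inner ξ η = Θ η ξ) (z : V) :
    Continuous fun x : Renormed (VectorNorm.ofInner c) => Θ ((Renormed.mk _).symm x) z := by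
  let f : Renormed (VectorNorm.ofInner c) →ₗ[ℂ] ℂ :=
    { toFun := fun x => Θ ((Renormed.mk _).symm x) z
      map_add' := fun x y => by simp
      map_smul' := fun a x => by simp }
  refine AddMonoidHomClass.continuous_of_bound f (VectorNorm.ofInner c z) fun x => ?_
  have h : ‖c.inner z ((Renormed.mk _).symm x)‖ ≤
      √(c.inner z z).re * √(c.inner ((Renormed.mk _).symm x) ((Renormed.mk _).symm x)).re :=
    @InnerProductSpace.Core.norm_inner_le_norm ℂ V _ _ _ c.toCore z ((Renormed.mk _).symm x)
  rw [hc] at h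
  exact h

/-- All fundamental decompositions of a Krein space define the same topology. -/
theorem IsFundamentalDecomposition.exists_bound {Θ : SesqForm V} {P N P' N' : Submodule ℂ V}
    (hΘ : Θ.IsSymmetric) (h : IsFundamentalDecomposition Θ P N)
    (h' : IsFundamentalDecomposition Θ P' N') :
    ∃ C : ℝ, ∀ ξ ∈ P, ∀ η ∈ N, ∀ ξ' ∈ P', ∀ η' ∈ N', ξ + η = ξ' + η' →
      fundamentalNormSq Θ ξ η ≤ C * fundamentalNormSq Θ ξ' η' := by
  obtain ⟨c₁, hc₁, hcomp₁⟩ := h.pos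
  obtain ⟨c₂, hc₂, hcomp₂⟩ := h.neg
  obtain ⟨d₁, hd₁, hcomp₁'⟩ := h'.pos
  obtain ⟨d₂, hd₂, hcomp₂'⟩ := h'.neg
  let E := Renormed (VectorNorm.ofInner c₁) × Renormed (VectorNorm.ofInner c₂)
  let E' := Renormed (VectorNorm.ofInner d₁) × Renormed (VectorNorm.ofInner d₂)
  let S : E ≃ₗ[ℂ] V := ((Renormed.mk _).symm.prodCongr (Renormed.mk _).symm).trans
    (Submodule.prodEquivOfIsCompl P N h.isCompl)
  let S' : E' ≃ₗ[ℂ] V := ((Renormed.mk _).symm.prodCongr (Renormed.mk _).symm).trans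
    (Submodule.prodEquivOfIsCompl P' N' h'.isCompl)
  have horth (Q M : Submodule ℂ V) (hQ : IsFundamentalDecomposition Θ Q M) (q : V) (hq : q ∈ Q)
      (m : V) (hm : m ∈ M) : Θ m q = 0 := by
    rw [hΘ, hQ.orthogonal q hq m hm, map_zero]
  have hS (w : E) : S w = (((Renormed.mk _).symm w.1 : P) : V) + ((Renormed.mk _).symm w.2 : N) := rfl
  have hS' (w : E') : S' w = (((Renormed.mk _).symm w.1 : P') : V) + ((Renormed.mk _).symm w.2 : N') := rfl
  have hcont (z : V) : Continuous fun w : E => Θ (S w) z := by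
    obtain ⟨⟨p, n⟩, rfl⟩ := (Submodule.prodEquivOfIsCompl P N h.isCompl).surjective z
    have h1 := (IsHilbertForm.continuous_apply hc₁ p).comp (continuous_fst (X := Renormed
      (VectorNorm.ofInner c₁)) (Y := Renormed (VectorNorm.ofInner c₂)))
    have h2 := (IsHilbertForm.continuous_apply hc₂ n).comp (continuous_snd (X := Renormed
      (VectorNorm.ofInner c₁)) (Y := Renormed (VectorNorm.ofInner c₂)))
    refine (h1.sub h2).congr fun w => ?_
    have e1 : Θ (((Renormed.mk _).symm w.1 : P) : V) n = 0 := h.orthogonal _ ((Renormed.mk _).symm w.1 : P).2 _ n.2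
    have e2 : Θ (((Renormed.mk _).symm w.2 : N) : V) p = 0 := horth P N h _ p.2 _ ((Renormed.mk _).symm w.2 : N).2
    have e3 : Θ (S w) ((p : V) + n) = Θ (((Renormed.mk _).symm w.1 : P) : V) p + Θ (((Renormed.mk _).symm w.2 : N) : V) n := by
      rw [hS]
      simp [e1, e2]
    refine Eq.trans ?_ e3.symm
    change Θ (((Renormed.mk _).symm w.1 : P) : V) p - (-Θ (((Renormed.mk _).symm w.2 : N) : V) n) = _
    rw [sub_neg_eq_add]
  have hcont' (z : V) : Continuous fun w : E' => Θ (S' w) z := by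
    obtain ⟨⟨p, n⟩, rfl⟩ := (Submodule.prodEquivOfIsCompl P' N' h'.isCompl).surjective z
    have h1 := (IsHilbertForm.continuous_apply hd₁ p).comp (continuous_fst (X := Renormed
      (VectorNorm.ofInner d₁)) (Y := Renormed (VectorNorm.ofInner d₂)))
    have h2 := (IsHilbertForm.continuous_apply hd₂ n).comp (continuous_snd (X := Renormed
      (VectorNorm.ofInner d₁)) (Y := Renormed (VectorNorm.ofInner d₂)))
    refine (h1.sub h2).congr fun w => ?_
    have e1 : Θ (((Renormed.mk _).symm w.1 : P') : V) n = 0 := h'.orthogonal _ ((Renormed.mk _).symm w.1 : P').2 _ n.2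
    have e2 : Θ (((Renormed.mk _).symm w.2 : N') : V) p = 0 := horth P' N' h' _ p.2 _ ((Renormed.mk _).symm w.2 : N').2
    have e3 : Θ (S' w) ((p : V) + n) = Θ (((Renormed.mk _).symm w.1 : P') : V) p + Θ (((Renormed.mk _).symm w.2 : N') : V) n := by
      rw [hS']
      simp [e1, e2]
    refine Eq.trans ?_ e3.symm
    change Θ (((Renormed.mk _).symm w.1 : P') : V) p - (-Θ (((Renormed.mk _).symm w.2 : N') : V) n) = _
    rw [sub_neg_eq_add]
  have hnondeg (x : V) (hx : ∀ z, Θ x z = 0) : x = 0 := by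
    obtain ⟨⟨p, n⟩, rfl⟩ := (Submodule.prodEquivOfIsCompl P N h.isCompl).surjective x
    have hx' (z : V) : Θ ((p : V) + n) z = 0 := hx z
    have hp : p = 0 := by
      refine c₁.definite p ?_
      have := hx' p
      rw [map_add, LinearMap.add_apply, horth P N h _ p.2 _ n.2, add_zero] at this
      rw [hc₁]
      exact this
    have hn : n = 0 := by
      refine c₂.definite n ?_
      have := hx' n
      rw [map_add, LinearMap.add_apply, h.orthogonal _ p.2 _ n.2, zero_add] at this
      rw [hc₂]
      change -Θ (n : V) n = 0
      rw [this, neg_zero]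
    rw [hp, hn]
    exact map_zero _
  let T : E' →L[ℂ] E := ContinuousLinearMap.ofSeqClosedGraph
    (g := (S'.trans S.symm).toLinearMap) (by
      intro u x y hx hy
      have key : S y - S' x = 0 := hnondeg _ fun z => by
        have a1 := ((hcont z).tendsto y).comp hy
        have a2 := ((hcont' z).tendsto x).comp hx
        have a3 := tendsto_nhds_unique a1 (a2.congr fun k => by simp)
        rw [map_sub, LinearMap.sub_apply, sub_eq_zero]
        exact a3
      have key' : S y = S' x := sub_eq_zero.mp key
      change y = S.symm (S' x)
      rw [← key', LinearEquiv.symm_apply_apply])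
  refine ⟨2 * ‖T‖ ^ 2, fun ξ hξ η hη ξ' hξ' η' hη' he => ?_⟩
  let w : E := (Renormed.mk _ ⟨ξ, hξ⟩, Renormed.mk _ ⟨η, hη⟩)
  let w' : E' := (Renormed.mk _ ⟨ξ', hξ'⟩, Renormed.mk _ ⟨η', hη'⟩)
  have hT : T w' = w := by
    change S.symm (S' w') = w
    rw [LinearEquiv.symm_apply_eq]
    exact he.symm
  have hle : ‖w‖ ≤ ‖T‖ * ‖w'‖ := hT ▸ T.le_opNorm w'
  have sq {W : Type _} [AddCommGroup W] [Module ℂ W] (c : InnerProductSpace.Core ℂ W) (x : W) :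
      ‖Renormed.mk (VectorNorm.ofInner c) x‖ ^ 2 = (c.inner x x).re :=
    Real.sq_sqrt (c.re_inner_nonneg x)
  have q1 : ‖w.1‖ ^ 2 = (Θ ξ ξ).re := by
    rw [sq, hc₁]
    rfl
  have q2 : ‖w.2‖ ^ 2 = -(Θ η η).re := by
    rw [sq, hc₂]
    rfl
  have q3 : ‖w'.1‖ ^ 2 = (Θ ξ' ξ').re := by
    rw [sq, hd₁]
    rfl
  have q4 : ‖w'.2‖ ^ 2 = -(Θ η' η').re := by
    rw [sq, hd₂]
    rfl
  have b1 : ‖w.1‖ ^ 2 ≤ ‖w‖ ^ 2 := pow_le_pow_left₀ (norm_nonneg _) (norm_fst_le w) 2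
  have b2 : ‖w.2‖ ^ 2 ≤ ‖w‖ ^ 2 := pow_le_pow_left₀ (norm_nonneg _) (norm_snd_le w) 2
  have b3 : ‖w'‖ ^ 2 ≤ ‖w'.1‖ ^ 2 + ‖w'.2‖ ^ 2 := by
    rcases max_choice ‖w'.1‖ ‖w'.2‖ with hm | hm
    · rw [Prod.norm_def, hm]
      exact le_add_of_nonneg_right (sq_nonneg _)
    · rw [Prod.norm_def, hm]
      exact le_add_of_nonneg_left (sq_nonneg _)
  have b4 : ‖w‖ ^ 2 ≤ ‖T‖ ^ 2 * ‖w'‖ ^ 2 := by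
    rw [← mul_pow]
    exact pow_le_pow_left₀ (norm_nonneg _) hle 2
  have b5 := mul_le_mul_of_nonneg_left b3 (sq_nonneg ‖T‖)
  rw [q3, q4] at b5
  unfold fundamentalNormSq
  nlinarith

/-- The Krein space `(D, Θ)` is continuously embedded in `H`: the inclusion of `D` in `H` is
continuous for the Hilbert space topology of `(D, Θ)`. -/
def IsKreinSpaceEmbedded {H : Type*} [NormedAddCommGroup H] [InnerProductSpace ℂ H]
    {D : Submodule ℂ H} (Θ : SesqForm D) : Prop :=
  IsKreinSpace Θ ∧ ∀ P N : Submodule ℂ D, IsFundamentalDecomposition Θ P N →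
    ∃ C : ℝ, ∀ ξ ∈ P, ∀ η ∈ N, ‖((ξ + η : D) : H)‖ ^ 2 ≤ C * fundamentalNormSq Θ ξ η

/-- The symmetric form `Ω` is closed with gap point `lam`, in the sense of Fleige, Hassi and
de Snoo. -/
def IsClosedWithGapPoint {H : Type*} [NormedAddCommGroup H] [InnerProductSpace ℂ H]
    {D : Submodule ℂ H} (Ω : SesqForm D) (lam : ℂ) : Prop :=
  Ω.IsSymmetric ∧ IsKreinSpaceEmbedded (Ω - lam • (iotaForm H).restrict D)

end Krein

end

/-! Write Θ = Ω + Υ. Given a complete inner product norm on D for which Θ is bounded, Θ has a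
bounded self-adjoint Gram operator T. The two conditions defining 𝔓(Ω) say exactly that T is
injective and onto, hence invertible, so its spectrum has a gap around 0. The spectral projection of
T for the positive reals (`exists_spectral_projection`) splits D into a part where Θ is uniformly
positive and one where it is uniformly negative. On each part ±Θ is equivalent to the given norm,
which gives a fundamental decomposition (`exists_isFundamentalDecomposition`). The embedding in H is
continuous for the given norm, hence for the Krein topology.

Conversely, a fundamental decomposition yields a Hilbert space structure in which Θ is the inner
product twisted by an isometric involution J (`IsFundamentalDecomposition.exists_symmetry`). Riesz
representation followed by J then solves Λ = Θ(ξ, ·) uniquely. Completeness with the continuous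
embedding gives compatibility, Hilbert spaces are reflexive, and Ω = Θ - Υ is bounded because both
terms are. The corollary is the case Υ = -λι. -/

/-! ### Riesz representation, reflexivity and spectral projections in Hilbert spaces -/

section Hilbert

variable {E : Type*} [NormedAddCommGroup E] [InnerProductSpace ℂ E] [CompleteSpace E]

/-- The Riesz representation of a bounded conjugate linear functional. -/
theorem exists_inner_eq_of_conjLinear (Λ : E →L⋆[ℂ] ℂ) : ∃ x : E, ∀ y : E, Λ y = ⟪y, x⟫_ℂ := by
  let φ : E →L[ℂ] ℂ := ((starL ℂ : ℂ ≃L⋆[ℂ] ℂ) : ℂ →L⋆[ℂ] ℂ).comp Λ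
  refine ⟨(InnerProductSpace.toDual ℂ E).symm φ, fun y => ?_⟩
  rw [← inner_conj_symm, InnerProductSpace.toDual_symm_apply]
  simp [φ]

/-- Precomposing an element of the double dual with the conjugate linear Riesz map gives a bounded
conjugate linear functional on `E`; the vector representing it is the preimage sought. -/
theorem IsReflexiveSpace.of_innerProductSpace : IsReflexiveSpace E := by
  intro F
  obtain ⟨x, hx⟩ := exists_inner_eq_of_conjLinear
    (F.comp ((InnerProductSpace.toDual ℂ E).toContinuousLinearEquiv : E →L⋆[ℂ] StrongDual ℂ E))
  refine ⟨x, ContinuousLinearMap.ext fun f => ?_⟩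
  obtain ⟨y, rfl⟩ := (InnerProductSpace.toDual ℂ E).surjective f
  rw [NormedSpace.dual_def, InnerProductSpace.toDual_apply_apply]
  exact (hx y).symm

/-- The spectral projection of an invertible self-adjoint operator `T` for the positive reals
commutes with `T`, and `T` is uniformly positive on its range and uniformly negative on its
kernel. -/
theorem exists_spectral_projection {T : E →L[ℂ] E} (hT : IsSelfAdjoint T) (hu : IsUnit T) :
    ∃ (p : E →L[ℂ] E) (δ : ℝ), 0 < δ ∧ IsSelfAdjoint p ∧ p * p = p ∧ Commute p T ∧
      (∀ x, p x = x → δ * ‖x‖ ^ 2 ≤ (⟪T x, x⟫_ℂ).re) ∧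
      ∀ x, p x = 0 → δ * ‖x‖ ^ 2 ≤ -(⟪T x, x⟫_ℂ).re := by
  have h0 : (0 : ℝ) ∈ (spectrum ℝ T)ᶜ := (spectrum.zero_notMem_iff ℝ).mpr hu
  obtain ⟨δ, hδ, hball⟩ := Metric.isOpen_iff.mp (spectrum.isClosed (𝕜 := ℝ) T).isOpen_compl 0 h0
  have hgap (x : ℝ) (hx : x ∈ spectrum ℝ T) : δ ≤ |x| := by
    by_contra! h
    exact hball (by simpa using h) hx
  -- A continuous ramp from 0 at -δ to 1 at δ. The spectrum avoids (-δ, δ), so there `f` is the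
  -- indicator of the positive reals and the continuous functional calculus suffices.
  let f : ℝ → ℝ := fun x => max 0 (min 1 ((x + δ) / (2 * δ)))
  have hf : Continuous f := by fun_prop
  have hf1 (x : ℝ) (hx : δ ≤ x) : f x = 1 := by
    have : 1 ≤ (x + δ) / (2 * δ) := by rw [le_div_iff₀ (by positivity)]; linarith
    simp [f, this]
  have hf0 (x : ℝ) (hx : x ≤ -δ) : f x = 0 := by
    have : (x + δ) / (2 * δ) ≤ 0 := div_nonpos_of_nonpos_of_nonneg (by linarith) (by positivity)
    simp [f, this]
  have hcases (x : ℝ) (hx : x ∈ spectrum ℝ T) : (δ ≤ x ∧ f x = 1) ∨ (x ≤ -δ ∧ f x = 0) := by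
    rcases le_abs.mp (hgap x hx) with h | h
    · exact .inl ⟨h, hf1 x h⟩
    · exact .inr ⟨by linarith, hf0 x (by linarith)⟩
  have hpos (S : E →L[ℂ] E) (hS : 0 ≤ S) (x : E) : 0 ≤ (⟪S x, x⟫_ℂ).re :=
    ((ContinuousLinearMap.nonneg_iff_isPositive S).mp hS).2 x
  have hid : cfc (fun x : ℝ => x) T = T := cfc_id' ℝ T
  have hconst (r : ℝ) : cfc (fun _ : ℝ => r) T = algebraMap ℝ _ r := cfc_const r T
  -- On vectors fixed by `cfc f T` this operator acts as T - δ, whence the lower bound on the range.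
  have hP : 0 ≤ (T - algebraMap ℝ _ δ) * cfc f T := by
    rw [← hconst δ]
    nth_rw 1 [← hid]
    rw [← cfc_sub (fun x : ℝ => x) (fun _ => δ) T,
      ← cfc_mul (fun x : ℝ => x - δ) f T (by fun_prop) hf.continuousOn]
    refine cfc_nonneg fun x hx => ?_
    rcases hcases x hx with ⟨h, e⟩ | ⟨h, e⟩
    · rw [e]; linarith
    · rw [e]; simp
  -- On the kernel of `cfc f T` this operator acts as -(T + δ), whence the bound for -T there.
  have hN : 0 ≤ (T + algebraMap ℝ _ δ) * (cfc f T - algebraMap ℝ _ 1) := by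
    rw [← hconst δ, ← hconst 1]
    nth_rw 1 [← hid]
    rw [← cfc_add (a := T) (fun x : ℝ => x) (fun _ => δ),
      ← cfc_sub f (fun _ => 1) T hf.continuousOn,
      ← cfc_mul (fun x : ℝ => x + δ) (fun x => f x - 1) T (by fun_prop) (by fun_prop)]
    refine cfc_nonneg fun x hx => ?_
    rcases hcases x hx with ⟨h, e⟩ | ⟨h, e⟩
    · rw [e]; simp
    · rw [e]; linarith
  have halg (r : ℝ) (x : E) : ⟪(algebraMap ℝ (E →L[ℂ] E) r) x, x⟫_ℂ = (r * ‖x‖ ^ 2 : ℝ) := by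
    rw [Algebra.algebraMap_eq_smul_one]
    have : (r • (1 : E →L[ℂ] E)) x = (r : ℂ) • x := by simp
    rw [this, inner_smul_left, inner_self_eq_norm_sq_to_K]
    simp
  refine ⟨cfc f T, δ, hδ, cfc_predicate f T, ?_, ?_, fun x hx => ?_, fun x hx => ?_⟩
  · rw [← cfc_mul f f T hf.continuousOn hf.continuousOn]
    refine cfc_congr fun x hx => ?_
    rcases hcases x hx with ⟨-, e⟩ | ⟨-, e⟩ <;> simp [e]
  · simpa only [hid] using cfc_commute_cfc f (fun x : ℝ => x) T
  · have := hpos _ hP x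
    rw [mul_apply_eq_comp, hx, sub_apply, inner_sub_left, halg,
      Complex.sub_re, Complex.ofReal_re] at this
    linarith
  · have := hpos _ hN x
    rw [map_one, mul_apply_eq_comp, sub_apply, hx,
      one_apply_eq_self, zero_sub, map_neg, inner_neg_left,
      add_apply, inner_add_left, halg, Complex.neg_re, Complex.add_re,
      Complex.ofReal_re] at this
    linarith

end Hilbert

/-! ### Inner product norms and equivalent forms -/

section InnerNorm

variable {V : Type*} [AddCommGroup V] [Module ℂ V]

theorem VectorNorm.ofInner_sq (c : InnerProductSpace.Core ℂ V) (x : V) :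
    VectorNorm.ofInner c x ^ 2 = (c.inner x x).re :=
  Real.sq_sqrt (c.re_inner_nonneg x)

noncomputable instance Renormed.instInnerProductSpace (c : InnerProductSpace.Core ℂ V) :
    InnerProductSpace ℂ (Renormed (VectorNorm.ofInner c)) where
  inner x y := c.inner ((Renormed.mk _).symm x) ((Renormed.mk _).symm y)
  norm_sq_eq_re_inner x := VectorNorm.ofInner_sq c ((Renormed.mk _).symm x)
  conj_inner_symm _ _ := c.conj_inner_symm _ _
  add_left _ _ _ := c.add_left _ _ _
  smul_left _ _ _ := c.smul_left _ _ _

theorem Renormed.inner_mk (c : InnerProductSpace.Core ℂ V) (x y : V) :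
    ⟪Renormed.mk (VectorNorm.ofInner c) x, Renormed.mk (VectorNorm.ofInner c) y⟫_ℂ =
      c.inner x y := rfl

/-- A symmetric form is an inner product making the space complete as soon as it is equivalent
to the norm pulled back along a linear map with complete range. -/
theorem IsHilbertForm.of_equivalent {E : Type*} [NormedAddCommGroup E] [NormedSpace ℂ E]
    {Θ : SesqForm V} (hΘ : Θ.IsSymmetric) (j : V →ₗ[ℂ] E) (hj : Function.Injective j)
    (hrange : IsComplete (Set.range j)) {δ β : ℝ} (hδ : 0 < δ)
    (hlow : ∀ x, δ * ‖j x‖ ^ 2 ≤ (Θ x x).re) (hup : ∀ x, (Θ x x).re ≤ β * ‖j x‖ ^ 2) :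
    IsHilbertForm Θ := by
  let c : InnerProductSpace.Core ℂ V :=
    { inner := fun x y => Θ y x
      conj_inner_symm := fun x y => (hΘ y x).symm
      re_inner_nonneg := fun x => (by positivity : 0 ≤ δ * ‖j x‖ ^ 2).trans (hlow x)
      add_left := fun x y z => by simp
      smul_left := fun x y r => by simp
      definite := fun x hx => by
        have h := hlow x
        rw [show Θ x x = 0 from hx, Complex.zero_re] at h
        have h1 : ‖j x‖ ^ 2 ≤ 0 := nonpos_of_mul_nonpos_right h hδ
        refine hj ?_
        rw [map_zero, ← norm_eq_zero]
        exact pow_eq_zero_iff two_ne_zero |>.mp (le_antisymm h1 (sq_nonneg _)) }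
  refine ⟨c, fun _ _ => rfl, ?_⟩
  let g : Renormed (VectorNorm.ofInner c) →ₗ[ℂ] E := j ∘ₗ (Renormed.mk _).symm.toLinearMap
  have hg (x : Renormed (VectorNorm.ofInner c)) :
      δ * ‖g x‖ ^ 2 ≤ ‖x‖ ^ 2 ∧ ‖x‖ ^ 2 ≤ β * ‖g x‖ ^ 2 := by
    have e : ‖x‖ ^ 2 = _ := VectorNorm.ofInner_sq c ((Renormed.mk _).symm x)
    rw [e]
    exact ⟨hlow _, hup _⟩
  -- The upper bound makes `g` antilipschitz and the lower bound makes it Lipschitz, so completeness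
  -- transfers from its range.
  have hanti : AntilipschitzWith (√β).toNNReal g := by
    refine AddMonoidHomClass.antilipschitz_of_bound g fun x => ?_
    rw [Real.coe_toNNReal _ (Real.sqrt_nonneg _), ← Real.sqrt_sq (norm_nonneg (g x)),
      ← Real.sqrt_mul' _ (sq_nonneg _)]
    exact Real.le_sqrt_of_sq_le (hg x).2
  have hlip : LipschitzWith (√δ⁻¹).toNNReal g := by
    refine AddMonoidHomClass.lipschitz_of_bound g _ fun x => ?_
    rw [← Real.sqrt_sq (norm_nonneg x), ← Real.sqrt_mul' _ (sq_nonneg _)]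
    refine Real.le_sqrt_of_sq_le ?_
    rw [inv_mul_eq_div, le_div_iff₀' hδ]
    exact (hg x).1
  rw [completeSpace_iff_isComplete_range (hanti.isUniformInducing hlip.uniformContinuous)]
  exact hrange

end InnerNorm

/-! ### Fundamental decompositions and fundamental symmetries -/

section Decomposition

variable {V : Type*} [AddCommGroup V] [Module ℂ V]

/-- A bounded symmetric form on a Hilbert space which represents every bounded conjugate linear
functional exactly once has a fundamental decomposition, whose norm dominates the given one. -/
theorem exists_isFundamentalDecomposition {Θ : SesqForm V} (hΘ : Θ.IsSymmetric)
    (c : InnerProductSpace.Core ℂ V) (hc : CompleteSpace (Renormed (VectorNorm.ofInner c)))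
    {β : ℝ} (hβ : ∀ x y, ‖Θ x y‖ ≤ β * VectorNorm.ofInner c x * VectorNorm.ofInner c y)
    (hnd : ∀ x, (∀ y, Θ x y = 0) → x = 0)
    (hrep : ∀ Λ : Renormed (VectorNorm.ofInner c) →L⋆[ℂ] ℂ, ∃ x, ∀ y,
      Λ (Renormed.mk _ y) = Θ x y) :
    ∃ P N : Submodule ℂ V, IsFundamentalDecomposition Θ P N ∧ ∃ C : ℝ, 0 ≤ C ∧ ∀ ξ ∈ P, ∀ η ∈ N,
      VectorNorm.ofInner c (ξ + η) ^ 2 ≤ C * fundamentalNormSq Θ ξ η := by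
  set m := Renormed.mk (VectorNorm.ofInner c)
  -- The arguments are swapped because the inner product of Mathlib is conjugate linear in its first
  -- slot; `T` is then the Gram operator of Θ.
  let B : Renormed (VectorNorm.ofInner c) →L⋆[ℂ] Renormed (VectorNorm.ofInner c) →L[ℂ] ℂ :=
    LinearMap.mkContinuous₂ (LinearMap.mk₂'ₛₗ (starRingEnd ℂ) (RingHom.id ℂ)
      (fun v w => Θ (m.symm w) (m.symm v)) (by simp) (by simp) (by simp) (by simp)) β
      (fun v w => (hβ (m.symm w) (m.symm v)).trans_eq (mul_right_comm _ _ _))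
  let T := InnerProductSpace.continuousLinearMapOfBilin B
  have hTΘ (x y : V) : ⟪T (m x), m y⟫_ℂ = Θ y x :=
    InnerProductSpace.continuousLinearMapOfBilin_apply B (m x) (m y)
  have hTΘ' (x y : V) : ⟪m x, T (m y)⟫_ℂ = Θ y x := by
    rw [← inner_conj_symm, hTΘ, ← hΘ]
  have hsa : IsSelfAdjoint T := by
    refine ContinuousLinearMap.isSelfAdjoint_iff_isSymmetric.mpr fun x y => ?_
    obtain ⟨x, rfl⟩ := m.surjective x
    obtain ⟨y, rfl⟩ := m.surjective y
    exact (hTΘ x y).trans (hTΘ' x y).symm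
  have hu : IsUnit T := by
    refine ContinuousLinearMap.isUnit_iff_bijective.mpr ⟨?_, fun y => ?_⟩
    · refine (injective_iff_map_eq_zero T).mpr fun x hx => ?_
      obtain ⟨x, rfl⟩ := m.surjective x
      rw [hnd x fun y => by rw [← hTΘ' y x, hx, inner_zero_right], map_zero]
    · obtain ⟨x, hx⟩ := hrep ((innerSL ℂ).flip y)
      refine ⟨m x, ext_inner_left ℂ fun w => ?_⟩
      obtain ⟨w, rfl⟩ := m.surjective w
      rw [hTΘ']
      exact (hx w).symm
  obtain ⟨p, δ, hδ, hpsa, hpp, hpT, hpos, hneg⟩ := exists_spectral_projection hsa hu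
  have hpp' (x) : p (p x) = p x := DFunLike.congr_fun hpp x
  have hsq (x : V) : ‖m x‖ ^ 2 = VectorNorm.ofInner c x ^ 2 := rfl
  have hre (x : V) : (⟪T (m x), m x⟫_ℂ).re = (Θ x x).re := by rw [hTΘ]
  have hup (x : V) : |(Θ x x).re| ≤ β * ‖m x‖ ^ 2 := by
    refine (Complex.abs_re_le_norm _).trans ((hβ x x).trans_eq ?_)
    rw [hsq]
    ring
  let P : Submodule ℂ V := (LinearMap.eqLocus p.toLinearMap LinearMap.id).comap m.toLinearMap
  let N : Submodule ℂ V := (LinearMap.ker p.toLinearMap).comap m.toLinearMap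
  have memP (x : V) : x ∈ P ↔ p (m x) = m x := Iff.rfl
  have memN (x : V) : x ∈ N ↔ p (m x) = 0 := Iff.rfl
  have hP (x : V) (hx : x ∈ P) : δ * ‖m x‖ ^ 2 ≤ (Θ x x).re := hre x ▸ hpos (m x) hx
  have hN (x : V) (hx : x ∈ N) : δ * ‖m x‖ ^ 2 ≤ -(Θ x x).re := hre x ▸ hneg (m x) hx
  -- The 2 comes from (a + b)² ≤ 2(a² + b²), and 1/δ from the uniform definiteness on `P` and `N`.
  refine ⟨P, N, ⟨⟨?_, ?_⟩, fun ξ hξ η hη => ?_, ?_, ?_⟩, 2 / δ, by positivity, fun ξ hξ η hη => ?_⟩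
  · refine Submodule.disjoint_def.mpr fun x hx hx' => ?_
    rw [memP] at hx
    rw [memN, hx] at hx'
    exact m.map_eq_zero_iff.mp hx'
  · refine Submodule.codisjoint_iff_exists_add_eq.mpr fun x =>
      ⟨m.symm (p (m x)), x - m.symm (p (m x)), ?_, ?_, add_sub_cancel _ _⟩
    · rw [memP, m.apply_symm_apply, hpp']
    · rw [memN, map_sub, m.apply_symm_apply, map_sub, hpp', sub_self]
  -- Θ(ξ, η) = ⟪Tη, pξ⟫ = ⟪pTη, ξ⟫ = ⟪Tpη, ξ⟫ = 0.
  · rw [← hTΘ, ← (memP ξ).mp hξ]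
    have h1 := (ContinuousLinearMap.isSelfAdjoint_iff_isSymmetric.mp hpsa) (T (m η)) (m ξ)
    have h2 : p (T (m η)) = T (p (m η)) := DFunLike.congr_fun hpT (m η)
    refine h1.symm.trans ?_
    change ⟪p (T (m η)), m ξ⟫_ℂ = 0
    rw [h2, (memN η).mp hη, map_zero, inner_zero_left]
  · refine IsHilbertForm.of_equivalent (fun _ _ => hΘ _ _) (m.toLinearMap ∘ₗ P.subtype)
      (m.injective.comp P.injective_subtype) ?_ hδ (fun x => hP x x.2)
      (fun x => (le_abs_self _).trans (hup x))
    have : Set.range (m.toLinearMap ∘ₗ P.subtype) = {x | p x = x} := by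
      ext x
      exact ⟨fun ⟨y, hy⟩ => hy ▸ y.2, fun hx => ⟨⟨m.symm x, hx⟩, rfl⟩⟩
    rw [this]
    exact (isClosed_eq p.continuous continuous_id).isComplete
  · refine IsHilbertForm.of_equivalent (fun x y => ?_) (m.toLinearMap ∘ₗ N.subtype)
      (m.injective.comp N.injective_subtype) ?_ hδ (fun x => hN x x.2)
      (fun x => (neg_le_abs _).trans (hup x))
    · change -Θ x y = conj (-Θ y x)
      rw [map_neg, ← hΘ]
    have : Set.range (m.toLinearMap ∘ₗ N.subtype) = {x | p x = 0} := by
      ext x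
      exact ⟨fun ⟨y, hy⟩ => hy ▸ y.2, fun hx => ⟨⟨m.symm x, hx⟩, rfl⟩⟩
    rw [this]
    exact (isClosed_eq p.continuous continuous_const).isComplete
  · have h1 := hP ξ hξ
    have h2 := hN η hη
    have h3 : ‖m ξ + m η‖ ^ 2 ≤ 2 * (‖m ξ‖ ^ 2 + ‖m η‖ ^ 2) :=
      (pow_le_pow_left₀ (norm_nonneg _) (norm_add_le _ _) 2).trans add_sq_le
    rw [← hsq, map_add, div_mul_eq_mul_div, le_div_iff₀ hδ, fundamentalNormSq]
    nlinarith

/-- The Hilbert space structure given by a fundamental decomposition of a Krein space, with its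
fundamental symmetry `J`. -/
theorem IsFundamentalDecomposition.exists_symmetry {Θ : SesqForm V} {P N : Submodule ℂ V}
    (hΘ : Θ.IsSymmetric) (h : IsFundamentalDecomposition Θ P N) :
    ∃ (c : InnerProductSpace.Core ℂ V) (J : V → V),
      CompleteSpace (Renormed (VectorNorm.ofInner c)) ∧ (∀ x y, Θ x y = c.inner y (J x)) ∧
      (∀ x, J (J x) = x) ∧ (∀ x, VectorNorm.ofInner c (J x) = VectorNorm.ofInner c x) ∧
      ∀ x, ∃ ξ ∈ P, ∃ η ∈ N, x = ξ + η ∧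
        VectorNorm.ofInner c x ^ 2 = fundamentalNormSq Θ ξ η := by
  obtain ⟨c₁, hc₁, _⟩ := h.pos
  obtain ⟨c₂, hc₂, _⟩ := h.neg
  let e : V ≃ₗ[ℂ] P × N := (Submodule.prodEquivOfIsCompl P N h.isCompl).symm
  have he (x : V) : x = (e x).1 + (e x).2 :=
    ((Submodule.prodEquivOfIsCompl P N h.isCompl).apply_symm_apply x).symm
  -- The orthogonal sum of Θ on `P` and -Θ on `N`.
  let c : InnerProductSpace.Core ℂ V :=
    { inner := fun x y => c₁.inner (e x).1 (e y).1 + c₂.inner (e x).2 (e y).2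
      conj_inner_symm := fun x y => by
        rw [map_add, c₁.conj_inner_symm, c₂.conj_inner_symm]
      re_inner_nonneg := fun x => by
        rw [map_add]
        exact add_nonneg (c₁.re_inner_nonneg _) (c₂.re_inner_nonneg _)
      add_left := fun x y z => by
        rw [map_add, Prod.fst_add, Prod.snd_add, c₁.add_left, c₂.add_left]
        ring
      smul_left := fun x y r => by
        rw [map_smul, Prod.smul_fst, Prod.smul_snd, c₁.smul_left, c₂.smul_left]
        ring
      definite := fun x hx => by
        have h1 : 0 ≤ (c₁.inner (e x).1 (e x).1).re := c₁.re_inner_nonneg (e x).1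
        have h2 : 0 ≤ (c₂.inner (e x).2 (e x).2).re := c₂.re_inner_nonneg (e x).2
        have h3 := congrArg Complex.re hx
        rw [Complex.add_re, Complex.zero_re] at h3
        have n1 : VectorNorm.ofInner c₁ (e x).1 = 0 := by
          rw [← sq_eq_zero_iff, VectorNorm.ofInner_sq]
          exact le_antisymm (by linarith) h1
        have n2 : VectorNorm.ofInner c₂ (e x).2 = 0 := by
          rw [← sq_eq_zero_iff, VectorNorm.ofInner_sq]
          exact le_antisymm (by linarith) h2
        rw [he x, VectorNorm.eq_zero_of_apply_eq_zero _ _ n1,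
          VectorNorm.eq_zero_of_apply_eq_zero _ _ n2]
        simp }
  have hin (x y : V) : c.inner x y = c₁.inner (e x).1 (e y).1 + c₂.inner (e x).2 (e y).2 := rfl
  let J : V → V := fun x => e.symm ((e x).1, -(e x).2)
  have hJ (x : V) : e (J x) = ((e x).1, -(e x).2) := e.apply_symm_apply _
  have hneg₁ (x y : N) : c₂.inner x (-y) = -c₂.inner x y := by
    rw [hc₂, hc₂]
    simp
  have hneg₂ (x y : N) : c₂.inner (-x) y = -c₂.inner x y := by
    rw [hc₂, hc₂]
    simp
  have hΘ₁ (x y : V) : c₁.inner (e y).1 (e x).1 = Θ (e x).1 (e y).1 := hc₁ _ _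
  have hΘ₂ (x y : V) : c₂.inner (e y).2 (e x).2 = -Θ (e x).2 (e y).2 := hc₂ _ _
  have hsq (x : V) : VectorNorm.ofInner c x ^ 2 =
      VectorNorm.ofInner c₁ (e x).1 ^ 2 + VectorNorm.ofInner c₂ (e x).2 ^ 2 := by
    rw [VectorNorm.ofInner_sq, VectorNorm.ofInner_sq, VectorNorm.ofInner_sq, hin, Complex.add_re]
  refine ⟨c, J, ?_, fun x y => ?_, fun x => ?_, fun x => ?_,
    fun x => ⟨_, (e x).1.2, _, (e x).2.2, he x, ?_⟩⟩
  · let g : Renormed (VectorNorm.ofInner c) ≃ₗ[ℂ]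
        Renormed (VectorNorm.ofInner c₁) × Renormed (VectorNorm.ofInner c₂) :=
      ((Renormed.mk _).symm.trans e).trans ((Renormed.mk _).prodCongr (Renormed.mk _))
    have hg (x : Renormed (VectorNorm.ofInner c)) :
        ‖x‖ ^ 2 = ‖(g x).1‖ ^ 2 + ‖(g x).2‖ ^ 2 := hsq ((Renormed.mk _).symm x)
    have hlip : LipschitzWith (1 : ℝ).toNNReal g := by
      refine AddMonoidHomClass.lipschitz_of_bound g 1 fun x => ?_
      rw [one_mul]
      refine norm_prod_le_iff.mpr ⟨?_, ?_⟩ <;>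
        exact le_of_sq_le_sq (by nlinarith [hg x, sq_nonneg ‖(g x).1‖, sq_nonneg ‖(g x).2‖])
          (norm_nonneg _)
    have hanti : AntilipschitzWith 2 g := by
      refine AddMonoidHomClass.antilipschitz_of_bound g fun x => ?_
      have h1 := norm_fst_le (g x)
      have h2 := norm_snd_le (g x)
      refine le_of_sq_le_sq ?_ (by positivity)
      rw [hg x, NNReal.coe_ofNat]
      nlinarith [norm_nonneg (g x).1, norm_nonneg (g x).2]
    exact ((hanti.isUniformInducing hlip.uniformContinuous).completeSpace_congr g.surjective).mpr
      inferInstance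
  · rw [hin, hJ, hneg₁, hΘ₁, hΘ₂, neg_neg]
    nth_rw 1 [he x, he y]
    rw [map_add, map_add, LinearMap.add_apply, LinearMap.add_apply,
      h.orthogonal _ (e x).1.2 _ (e y).2.2, hΘ (e x).2, h.orthogonal _ (e y).1.2 _ (e x).2.2]
    simp
  · apply e.injective
    rw [hJ, hJ, neg_neg]
  · rw [VectorNorm.ofInner_apply, VectorNorm.ofInner_apply, hin, hin, hJ, hneg₁, hneg₂, neg_neg]
  · rw [VectorNorm.ofInner_sq, hin, hΘ₁, hΘ₂, fundamentalNormSq, Complex.add_re, Complex.neg_re,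
      sub_eq_add_neg]

end Decomposition

/-! ### Solvable forms and embedded Krein spaces -/

section Main

variable {H : Type*} [NormedAddCommGroup H] [InnerProductSpace ℂ H] {D : Submodule ℂ H}

theorem BoundedSesqForm.restrict_apply (Υ : BoundedSesqForm H) (ξ η : D) :
    Υ.restrict D ξ η = Υ (ξ : H) (η : H) := rfl

/-- A bounded form is bounded in every norm of a continuously embedded subspace. -/
theorem BoundedSesqForm.norm_restrict_le (Υ : BoundedSesqForm H) {ν : VectorNorm D} {α : ℝ}
    (hα : ∀ ξ : D, ‖(ξ : H)‖ ≤ α * ν ξ) (ξ η : D) :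
    ‖Υ.restrict D ξ η‖ ≤ ‖Υ‖ * α ^ 2 * ν ξ * ν η :=
  calc ‖Υ (ξ : H) (η : H)‖ ≤ ‖Υ‖ * ‖(ξ : H)‖ * ‖(η : H)‖ := Υ.le_opNorm₂ _ _
    _ ≤ ‖Υ‖ * (α * ν ξ) * (α * ν η) := by
      have := hα ξ
      have := hα η
      have := (norm_nonneg (ξ : H)).trans (hα ξ)
      gcongr
    _ = ‖Υ‖ * α ^ 2 * ν ξ * ν η := by ring

/-- A complete norm for which the embedding in `H` is continuous is compatible. -/
theorem IsCompatibleNorm.of_completeSpace {ν : VectorNorm D} (hν : CompleteSpace (Renormed ν))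
    (h : ∃ α > 0, ∀ ξ : D, ‖(ξ : H)‖ ≤ α * ν ξ) : IsCompatibleNorm ν where
  embedding := h
  closable u hu hcau := by
    obtain ⟨α, -, hα⟩ := h
    have hc : CauchySeq fun n => Renormed.mk ν (u n) := by
      rw [cauchySeq_iff_tendsto_dist_atTop_0]
      simp_rw [dist_eq_norm, ← map_sub]
      rw [← prod_atTop_atTop_eq] at hcau ⊢
      exact hcau
    obtain ⟨x, hx⟩ := cauchySeq_tendsto_of_complete hc
    have hx' : Tendsto (fun n => ν (u n - (Renormed.mk ν).symm x)) atTop (𝓝 0) :=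
      tendsto_iff_norm_sub_tendsto_zero.mp hx
    have hH : Tendsto (fun n => (u n : H)) atTop (𝓝 ((Renormed.mk ν).symm x : D)) := by
      refine tendsto_iff_norm_sub_tendsto_zero.mpr
        (squeeze_zero (fun _ => norm_nonneg _) (fun n => hα (u n - (Renormed.mk ν).symm x)) ?_)
      simpa using hx'.const_mul α
    -- The ν-limit is also the limit in `H`, which is 0 by assumption.
    have h0 : (Renormed.mk ν).symm x = 0 := Subtype.ext
      (tendsto_nhds_unique hH (tendsto_zero_iff_norm_tendsto_zero.mpr hu))
    simpa only [h0, sub_zero] using hx'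

/-- A form solvable with respect to an inner product gives rise to Krein spaces. -/
theorem IsQClosed.isKreinSpaceEmbedded {Ω : SesqForm D} {Υ : BoundedSesqForm H}
    {c : InnerProductSpace.Core ℂ D} (hΩ : IsQClosed Ω (VectorNorm.ofInner c))
    (hsym : (Ω + Υ.restrict D).IsSymmetric) (hΥ : Υ ∈ solvingForms Ω (VectorNorm.ofInner c)) :
    IsKreinSpaceEmbedded (Ω + Υ.restrict D) := by
  obtain ⟨α, hα0, hα⟩ := hΩ.compatible.embedding
  obtain ⟨β, -, hβ⟩ := hΩ.bounded
  have hb (x y : D) : ‖(Ω + Υ.restrict D) x y‖ ≤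
      (β + ‖Υ‖ * α ^ 2) * VectorNorm.ofInner c x * VectorNorm.ofInner c y := by
    refine (norm_add_le _ _).trans ((add_le_add (hβ x y) (Υ.norm_restrict_le hα x y)).trans_eq ?_)
    ring
  obtain ⟨P, N, hPN, C, hC0, hC⟩ :=
    exists_isFundamentalDecomposition hsym c hΩ.complete hb hΥ.1 hΥ.2
  refine ⟨⟨hsym, P, N, hPN⟩, fun P' N' hPN' => ?_⟩
  -- The embedding bound is required for every decomposition, so the spectral one is compared with
  -- an arbitrary one.
  obtain ⟨C', hC'⟩ := hPN.exists_bound hsym hPN'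
  refine ⟨α ^ 2 * (C * C'), fun ξ' hξ' η' hη' => ?_⟩
  obtain ⟨ξ, η, hξ, hη, he⟩ :=
    Submodule.codisjoint_iff_exists_add_eq.mp hPN.isCompl.codisjoint (ξ' + η')
  calc ‖((ξ' + η' : D) : H)‖ ^ 2 ≤ (α * VectorNorm.ofInner c (ξ' + η')) ^ 2 := by
        gcongr
        exact hα _
    _ = α ^ 2 * VectorNorm.ofInner c (ξ + η) ^ 2 := by rw [he, mul_pow]
    _ ≤ α ^ 2 * (C * (C' * fundamentalNormSq (Ω + Υ.restrict D) ξ' η')) := by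
        gcongr
        refine (hC ξ hξ η hη).trans ?_
        gcongr
        exact hC' ξ hξ η hη ξ' hξ' η' hη' he
    _ = _ := by ring

/-- A continuously embedded Krein space comes from a form solvable with respect to an inner
product. -/
theorem IsKreinSpaceEmbedded.exists_isSolvableForm {Ω : SesqForm D} {Υ : BoundedSesqForm H}
    (h : IsKreinSpaceEmbedded (Ω + Υ.restrict D)) :
    ∃ c : InnerProductSpace.Core ℂ D, IsSolvableForm Ω (VectorNorm.ofInner c) ∧
      Υ ∈ solvingForms Ω (VectorNorm.ofInner c) := by
  obtain ⟨⟨hsym, P, N, hPN⟩, hemb⟩ := h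
  obtain ⟨C, hC⟩ := hemb P N hPN
  obtain ⟨c, J, hcomp, hΘ, hJJ, hJ, hdec⟩ := hPN.exists_symmetry hsym
  have hα : ∃ α > 0, ∀ ξ : D, ‖(ξ : H)‖ ≤ α * VectorNorm.ofInner c ξ := by
    -- The maximum with 1 ensures positivity, as the sign of `C` is unknown.
    refine ⟨√(max C 1), Real.sqrt_pos.mpr (by positivity), fun x => ?_⟩
    obtain ⟨ξ, hξ, η, hη, rfl, hsq⟩ := hdec x
    refine le_of_sq_le_sq ?_ (mul_nonneg (Real.sqrt_nonneg _) (apply_nonneg _ _))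
    rw [mul_pow, Real.sq_sqrt (by positivity)]
    refine (hC ξ hξ η hη).trans ?_
    rw [← hsq]
    gcongr
    exact le_max_left _ _
  have hΥ : Υ ∈ solvingForms Ω (VectorNorm.ofInner c) := by
    refine ⟨fun x hx => ?_, fun Λ => ?_⟩
    -- Testing with y = J x gives Θ(x, J x) = ⟨J x, J x⟩.
    · have h0 : VectorNorm.ofInner c (J x) = 0 := by
        rw [VectorNorm.ofInner_apply, ← hΘ, hx, Complex.zero_re, Real.sqrt_zero]
      rw [hJ] at h0
      exact VectorNorm.eq_zero_of_apply_eq_zero _ _ h0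
    · obtain ⟨z, hz⟩ := exists_inner_eq_of_conjLinear Λ
      refine ⟨J ((Renormed.mk _).symm z), fun y => ?_⟩
      rw [hz, hΘ, hJJ]
      rfl
  refine ⟨c, ⟨⟨.of_completeSpace hcomp hα, hcomp, .of_innerProductSpace, ?_⟩, Υ, hΥ⟩, hΥ⟩
  obtain ⟨α, hα0, hα⟩ := hα
  refine ⟨1 + ‖Υ‖ * α ^ 2, by positivity, fun x y => ?_⟩
  have h1 : ‖(Ω + Υ.restrict D) x y‖ ≤ VectorNorm.ofInner c x * VectorNorm.ofInner c y := by
    rw [hΘ, ← Renormed.inner_mk, ← hJ x, mul_comm]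
    exact norm_inner_le_norm _ _
  calc ‖Ω x y‖ = ‖(Ω + Υ.restrict D) x y - Υ.restrict D x y‖ := by simp
    _ ≤ VectorNorm.ofInner c x * VectorNorm.ofInner c y +
        ‖Υ‖ * α ^ 2 * VectorNorm.ofInner c x * VectorNorm.ofInner c y :=
      (norm_sub_le _ _).trans (add_le_add h1 (Υ.norm_restrict_le hα x y))
    _ = _ := by ring

theorem isSolvableForm_iff_isKreinSpaceEmbedded {Ω : SesqForm D} {Υ : BoundedSesqForm H}
    (hsym : (Ω + Υ.restrict D).IsSymmetric) :
    (∃ c : InnerProductSpace.Core ℂ D, IsSolvableForm Ω (VectorNorm.ofInner c) ∧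
      Υ ∈ solvingForms Ω (VectorNorm.ofInner c)) ↔ IsKreinSpaceEmbedded (Ω + Υ.restrict D) :=
  ⟨fun ⟨_, hΩ, hΥ⟩ => hΩ.1.isKreinSpaceEmbedded hsym hΥ, fun h => h.exists_isSolvableForm⟩

end Main

theorem mainTheorem9 {H : Type*} [NormedAddCommGroup H] [InnerProductSpace ℂ H] [CompleteSpace H]
    (D : Submodule ℂ H) (hD : Dense (D : Set H)) (Ω : SesqForm D) :
    (∀ Υ : BoundedSesqForm H, (Ω + Υ.restrict D).IsSymmetric →
      ((∃ c : InnerProductSpace.Core ℂ D, IsSolvableForm Ω (VectorNorm.ofInner c) ∧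
          Υ ∈ solvingForms Ω (VectorNorm.ofInner c)) ↔
        IsKreinSpaceEmbedded (Ω + Υ.restrict D))) ∧
    (Ω.IsSymmetric → ∀ lam : ℝ,
      (IsClosedWithGapPoint Ω (lam : ℂ) ↔
        ∃ c : InnerProductSpace.Core ℂ D, IsSolvableForm Ω (VectorNorm.ofInner c) ∧
          (-(lam : ℂ)) • iotaForm H ∈ solvingForms Ω (VectorNorm.ofInner c))) := by
  refine ⟨fun Υ hsym => isSolvableForm_iff_isKreinSpaceEmbedded hsym, fun hΩ lam => ?_⟩
  have he : Ω - (lam : ℂ) • (iotaForm H).restrict D =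
      Ω + BoundedSesqForm.restrict ((-(lam : ℂ)) • iotaForm H) D := by
    ext x y
    simp [BoundedSesqForm.restrict_apply, sub_eq_add_neg]
  -- Here λ must be real: the shift by λι then preserves symmetry.
  have hsym : (Ω + BoundedSesqForm.restrict ((-(lam : ℂ)) • iotaForm H) D).IsSymmetric := by
    intro x y
    rw [← he]
    simp only [LinearMap.sub_apply, LinearMap.smul_apply, BoundedSesqForm.restrict_apply,
      iotaForm_apply, smul_eq_mul, map_sub, map_mul, Complex.conj_ofReal, inner_conj_symm, ← hΩ x y]
  rw [isSolvableForm_iff_isKreinSpaceEmbedded hsym, IsClosedWithGapPoint, he]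
  exact and_iff_right hΩ
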